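/- Let $N,K\ge 1$ and let $(F_n,G_n)_{n\in\mathbb Z}$ be a stationary and ergodic process of pairs of random matrices $F_n,G_n\in\mathbb C^{N\times K}$ (that is, the shift on $(\mathbb C^{N\times K}\times\mathbb C^{N\times K})^{\mathbb Z}$ preserves the law of the process and is ergodic for it) with $\mathbb E\|F_0\|^2<\infty$ and $\mathbb E\|G_0\|^2<\infty$, where $\|\cdot\|$ is the spectral norm. For $m\le n$ put $$H_{m,n}:=\begin{bmatrix}F_m&G_m\\&F_{m+1}&G_{m+1}\\&&\ddots&\ddots\\&&&F_n&G_n\end{bmatrix}\in\mathbb C^{(n-m+1)N\times(n-m+2)K},$$ and for $m<n$ put $$\mathring H_{m,n}:=\begin{bmatrix}G_m&&&F_m\\F_{m+1}&G_{m+1}\\&\ddots&\ddots\\&&F_n&G_n\end{bmatrix}\in\mathbb C^{(n-m+1)N\times(n-m+1)K}.$$ Let $\rho>0$. The mutual information per component $$\mathcal I_\rho:=\lim_{n-m\to\infty}\frac{\mathbb E\log\det(I+\rho H_{m,n}H_{m,n}^*)}{(n-m+1)N}=\operatorname*{a.s.\,lim}_{n-m\to\infty}\frac{\log\det(I+\rho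 H_{m,n}H_{m,n}^*)}{(n-m+1)N}$$ is well defined: the expectations and the first limit exist and are finite, and almost surely, for every $c\in\mathbb Z$, the second limit exists along the windows $[m,n]$ that contain $c$ and has the same value. Moreover $\log\det(I+\rho\mathring H_{0,M}\mathring H_{0,M}^*)$ is integrable for every $M\ge1$ and, as $M\to\infty$, $$\mathcal I_\rho=\frac1{(M+1)N}\,\mathbb E\log\det\left(I+\rho\,\mathring H_{0,M}\mathring H_{0,M}^*\right)+\mathcal O(1/M),$$ where $\mathcal O(1/M)$ is uniform in $K,N$ under a uniform bound on the second moments: for all $\rho>0$ and $B\in\mathbb R$ there is a constant $C$, depending only on $\rho$ and $B$, such that for all $N,K\ge1$, every process as above with $\mathbb E\|F_0\|^2\le B$ and $\mathbb E\|G_0\|^2\le B$, and every $M\ge1$, the error term is at most $C/M$ in absolute value. -/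

import Mathlib

open MeasureTheory Filter Topology
open scoped Matrix

noncomputable section

namespace ErgodicChannel

/-- The spectral norm of an `N × K` complex matrix, that is its operator norm as a map between
Euclidean spaces. -/
def specNorm {N K : ℕ} (A : Matrix (Fin N) (Fin K) ℂ) : ℝ :=
  ‖LinearMap.toContinuousLinearMap (Matrix.toEuclideanLin A)‖

/-- `E = ℂ^{N×K} × ℂ^{N×K}`, written with plain functions so that it carries the product (Borel)
sigma-algebra. -/
abbrev PairSpace (N K : ℕ) : Type :=
  (Fin N → Fin K → ℂ) × (Fin N → Fin K → ℂ)

/-- The shift on `E^ℤ`. -/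
def shift (N K : ℕ) (x : ℤ → PairSpace N K) : ℤ → PairSpace N K :=
  fun n => x (n + 1)

/-- The trajectory of the process `(F_n, G_n)_{n ∈ ℤ}`, a random element of `E^ℤ`. -/
def trajectory {N K : ℕ} {Ω : Type*} (F G : ℤ → Ω → Matrix (Fin N) (Fin K) ℂ) (ω : Ω) :
    ℤ → PairSpace N K :=
  fun n => (fun i j => F n ω i j, fun i j => G n ω i j)

/-- `(F_n, G_n)_{n ∈ ℤ}` is a stationary and ergodic process of pairs of random `N × K` matrices,
with `E ‖F_0‖² < ∞` and `E ‖G_0‖² < ∞`. -/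
structure IsErgodicChannel {N K : ℕ} {Ω : Type*} [MeasurableSpace Ω] (P : Measure Ω)
    (F G : ℤ → Ω → Matrix (Fin N) (Fin K) ℂ) : Prop where
  measurable_F : ∀ n i j, Measurable (fun ω => F n ω i j)
  measurable_G : ∀ n i j, Measurable (fun ω => G n ω i j)
  /-- The shift preserves the law of the process and is ergodic for it. -/
  ergodic : Ergodic (shift N K) (P.map (trajectory F G))
  moment_F : Integrable (fun ω => specNorm (F 0 ω) ^ 2) P
  moment_G : Integrable (fun ω => specNorm (G 0 ω) ^ 2) P

/-- The block bidiagonal matrix `H_{m,n}` with block rows indexed by `m, …, n`, block columns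
indexed by `m - 1, …, n`, and block row `i` equal to `[0 … 0 F_i G_i 0 … 0]`, where `F_i` is in
block column `i - 1` and `G_i` in block column `i`. -/
def bandMatrix {N K : ℕ} (F G : ℤ → Matrix (Fin N) (Fin K) ℂ) (m n : ℤ) :
    Matrix (Finset.Icc m n × Fin N) (Finset.Icc (m - 1) n × Fin K) ℂ :=
  Matrix.of fun i j =>
    if (j.1 : ℤ) = (i.1 : ℤ) then G i.1 i.2 j.2
    else if (j.1 : ℤ) = (i.1 : ℤ) - 1 then F i.1 i.2 j.2
    else 0

/-- The circularized block matrix, with block rows and block columns indexed by `m, …, n`: the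
blocks `G_m, …, G_n` are on the diagonal, `F_{m+1}, …, F_n` below the diagonal, and `F_m` is in
the top right corner. -/
def circMatrix {N K : ℕ} (F G : ℤ → Matrix (Fin N) (Fin K) ℂ) (m n : ℤ) :
    Matrix (Finset.Icc m n × Fin N) (Finset.Icc m n × Fin K) ℂ :=
  Matrix.of fun i j =>
    if (j.1 : ℤ) = (i.1 : ℤ) then G i.1 i.2 j.2
    else if (j.1 : ℤ) = (i.1 : ℤ) - 1 then F i.1 i.2 j.2
    else if (i.1 : ℤ) = m ∧ (j.1 : ℤ) = n then F i.1 i.2 j.2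
    else 0

/-- `log det (I + ρ A A*)`. The matrix is Hermitian positive definite for `ρ > 0`, so that its
determinant is a positive real number. -/
def logDet {r c : Type*} [Fintype r] [DecidableEq r] [Fintype c] (ρ : ℝ) (A : Matrix r c ℂ) : ℝ :=
  Real.log (1 + (ρ : ℂ) • (A * Aᴴ)).det.re

/-- `I` is the mutual information per component of the channel `(F_n, G_n)` at the signal to
noise ratio `ρ`: it is the limit, as `n - m → ∞`, of
`log det (I + ρ H_{m,n} H_{m,n}*) / ((n - m + 1) N)`, both in expectation and almost surely.
In the almost sure limit the windows `[m, n]` contain a given site `c`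
(for example `m = c` is fixed and `n → ∞`, or `n = c` is fixed and `m → -∞`). -/
structure IsMutualInformation {N K : ℕ} {Ω : Type*} [MeasurableSpace Ω] (P : Measure Ω)
    (F G : ℤ → Ω → Matrix (Fin N) (Fin K) ℂ) (ρ I : ℝ) : Prop where
  integrable : ∀ m n : ℤ, m ≤ n →
    Integrable (fun ω => logDet ρ (bandMatrix (fun k => F k ω) (fun k => G k ω) m n)) P
  tendsto_expectation :
    Tendsto
      (fun p : ℤ × ℤ => 1 / (((p.2 : ℝ) - p.1 + 1) * N) *
        ∫ ω, logDet ρ (bandMatrix (fun k => F k ω) (fun k => G k ω) p.1 p.2) ∂P)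
      (comap (fun p : ℤ × ℤ => p.2 - p.1) atTop) (𝓝 I)
  tendsto_ae : ∀ᵐ ω ∂P, ∀ c : ℤ,
    Tendsto
      (fun p : ℤ × ℤ => 1 / (((p.2 : ℝ) - p.1 + 1) * N) *
        logDet ρ (bandMatrix (fun k => F k ω) (fun k => G k ω) p.1 p.2))
      (comap (fun p : ℤ × ℤ => p.2 - p.1) atTop ⊓ 𝓟 {p | p.1 ≤ c ∧ c ≤ p.2}) (𝓝 I)

end ErgodicChannel

end

/-!
The log-determinant `L m n = log det (I + ρ H_{m,n} H_{m,n}*)` is almost additive in the window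
`[m, n]`. Deleting the block row `k` of `H_{m,n}` leaves a block diagonal matrix with blocks
`H_{m,k-1}` and `H_{k+1,n}`, and deleting rows `A₂` from a matrix lowers `log det (I + ρ A A*)` by
an amount between `0` and `ρ tr (A₂ A₂*)`: the quotient of the determinants is the determinant of a
Schur complement `I + X` with `0 ≤ X` and `tr X ≤ ρ tr (A₂ A₂*)` (`logDet_fromRows`). Hence
`|L m n - L m (k-1) - L k n| ≤ s k` with `s k = ρ ∑ (|F_k|² + |G_k|²)`
(`abs_logDet_bandMatrix_sub_le`). Deleting block row `0` of the circularized matrix gives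
`H_{1,M}`, as does deleting block row `0` of `H_{0,M}`, so that the log-determinants of these two
matrices differ by at most `s 0` (`abs_logDet_circMatrix_sub_bandMatrix_le`). Since the sum of the
squared moduli of the entries of an `N × K` matrix is at most `N` times its squared spectral norm,
`E s 0 ≤ 2 ρ B N`. This error enters twice, in passing from the circularized to the band matrix
and from the band matrix to the limit, so that the constant is `4 ρ B` after division by `N`.

In expectation, almost additivity and stationarity give a rate `J` with
`|E L m n - (n - m + 1) J| ≤ E s 0`, by Fekete's lemma applied from above and from below
(`exists_abs_sub_mul_le`). The almost sure limit along one-sided windows follows from Birkhoff's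
ergodic theorem (`tendsto_birkhoffSum_div`), which is proved here through the maximal function of
the Birkhoff sums: if `g n` is almost additive with error `s`, then `q * g n` differs from the
Birkhoff sum of `g q` by a Birkhoff sum of `s` and boundary terms that are `o(n)`
(`tendsto_almost_additive_div`). Applied to the shift and to its inverse this gives the growth to
the right and to the left of a site `c`, and almost additivity at `c` combines the two into a limit
along all windows that contain `c` (`tendsto_window_div`, `exists_growth_rate`).
-/

noncomputable section

namespace ErgodicChannel

/-! ### Determinants of the form `det (I + ρ A A*)` -/

section Determinant

open scoped ComplexOrder

variable {r r₁ r₂ c c₁ c₂ : Type*} [Fintype r] [DecidableEq r] [Fintype r₁] [DecidableEq r₁]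
  [Fintype r₂] [DecidableEq r₂] [Fintype c] [Fintype c₁] [Fintype c₂]

lemma det_one_add_of_posSemidef {X : Matrix r r ℂ} (hX : X.PosSemidef) :
    (1 + X).det = ((∏ i, (1 + hX.1.eigenvalues i) : ℝ) : ℂ) := by
  set U : Matrix r r ℂ := hX.1.eigenvectorUnitary.1 with hU
  have hUU : star U * U = 1 := Matrix.UnitaryGroup.star_mul_self hX.1.eigenvectorUnitary
  have h := hX.1.spectral_theorem
  rw [Unitary.conjStarAlgAut_apply] at h
  have h1 : (1 + X).det
      = (1 + Matrix.diagonal (RCLike.ofReal ∘ hX.1.eigenvalues) : Matrix r r ℂ).det := by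
    conv_lhs => rw [h, Matrix.mul_assoc, Matrix.det_one_add_mul_comm, Matrix.mul_assoc]
    rw [← hU, hUU, Matrix.mul_one]
  rw [h1, ← Matrix.diagonal_one, Matrix.diagonal_add, Matrix.det_diagonal]
  simp

lemma one_le_re_det_one_add {X : Matrix r r ℂ} (hX : X.PosSemidef) : 1 ≤ (1 + X).det.re := by
  rw [det_one_add_of_posSemidef hX, Complex.ofReal_re]
  have h : ∏ i : r, (1 : ℝ) ≤ ∏ i, (1 + hX.1.eigenvalues i) :=
    Finset.prod_le_prod (fun _ _ => zero_le_one) fun i _ => by linarith [hX.eigenvalues_nonneg i]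
  simpa using h

lemma im_det_one_add {X : Matrix r r ℂ} (hX : X.PosSemidef) : (1 + X).det.im = 0 := by
  rw [det_one_add_of_posSemidef hX, Complex.ofReal_im]

lemma log_re_det_one_add_le_trace {X : Matrix r r ℂ} (hX : X.PosSemidef) :
    Real.log (1 + X).det.re ≤ X.trace.re := by
  have h0 := fun i => hX.eigenvalues_nonneg i
  rw [det_one_add_of_posSemidef hX, Complex.ofReal_re, hX.1.trace_eq_sum_eigenvalues,
    Real.log_prod fun i _ => by linarith [h0 i], Complex.re_sum]
  refine Finset.sum_le_sum fun i _ => ?_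
  have := Real.log_le_sub_one_of_pos (show 0 < 1 + hX.1.eigenvalues i by linarith [h0 i])
  simpa using this

omit [DecidableEq r] in
lemma posSemidef_smul_mul_conjTranspose {ρ : ℝ} (hρ : 0 < ρ) (A : Matrix r c ℂ) :
    ((ρ : ℂ) • (A * Aᴴ)).PosSemidef :=
  (Matrix.posSemidef_self_mul_conjTranspose A).smul (by exact_mod_cast hρ.le)

lemma logDet_nonneg {ρ : ℝ} (hρ : 0 < ρ) (A : Matrix r c ℂ) : 0 ≤ logDet ρ A :=
  Real.log_nonneg (one_le_re_det_one_add (posSemidef_smul_mul_conjTranspose hρ A))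

lemma logDet_submatrix_equiv (ρ : ℝ) (A : Matrix r c ℂ) (e : r₁ ≃ r) (f : c₁ ≃ c) :
    logDet ρ (A.submatrix e f) = logDet ρ A := by
  have : (1 + (ρ : ℂ) • (A.submatrix e f * (A.submatrix e f)ᴴ))
      = (1 + (ρ : ℂ) • (A * Aᴴ)).submatrix e e := by
    rw [Matrix.conjTranspose_submatrix, Matrix.submatrix_mul_equiv, Matrix.submatrix_add,
      Matrix.submatrix_smul]
    simp
  rw [logDet, this, Matrix.det_submatrix_equiv_self, logDet]

lemma logDet_fromBlocks_diagonal {ρ : ℝ} (hρ : 0 < ρ) (X : Matrix r₁ c₁ ℂ) (Y : Matrix r₂ c₂ ℂ) :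
    logDet ρ (Matrix.fromBlocks X 0 0 Y) = logDet ρ X + logDet ρ Y := by
  have hX := posSemidef_smul_mul_conjTranspose hρ X
  have hY := posSemidef_smul_mul_conjTranspose hρ Y
  have : (1 + (ρ : ℂ) • (Matrix.fromBlocks X 0 0 Y * (Matrix.fromBlocks X 0 0 Y)ᴴ))
      = Matrix.fromBlocks (1 + (ρ : ℂ) • (X * Xᴴ)) 0 0 (1 + (ρ : ℂ) • (Y * Yᴴ)) := by
    rw [Matrix.fromBlocks_conjTranspose, Matrix.fromBlocks_multiply, Matrix.fromBlocks_smul,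
      ← Matrix.fromBlocks_one, Matrix.fromBlocks_add]
    simp
  rw [logDet, this, Matrix.det_fromBlocks_zero₂₁, Complex.mul_re, im_det_one_add hX, zero_mul,
    sub_zero, Real.log_mul (by linarith [one_le_re_det_one_add hX])
    (by linarith [one_le_re_det_one_add hY]), logDet, logDet]

omit [DecidableEq r] in
lemma re_trace_mul_conjTranspose (A : Matrix r c ℂ) :
    (A * Aᴴ).trace.re = ∑ i, ∑ j, ‖A i j‖ ^ 2 := by
  simp only [Matrix.trace, Matrix.diag_apply, Matrix.mul_apply, Matrix.conjTranspose_apply,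
    Complex.re_sum]
  refine Finset.sum_congr rfl fun i _ => Finset.sum_congr rfl fun j _ => ?_
  rw [Complex.star_def, Complex.mul_conj, Complex.ofReal_re, Complex.normSq_eq_norm_sq]

/-- Appending rows multiplies `det (I + ρ A A*)` by the determinant of a Schur complement, which
is `I` plus a positive semidefinite matrix dominated by the Gram matrix of the new rows. -/
lemma logDet_fromRows {ρ : ℝ} (hρ : 0 < ρ) (A₁ : Matrix r₁ c ℂ) (A₂ : Matrix r₂ c ℂ) :
    logDet ρ A₁ ≤ logDet ρ (Matrix.fromRows A₁ A₂) ∧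
      logDet ρ (Matrix.fromRows A₁ A₂) ≤ logDet ρ A₁ + ρ * ∑ i, ∑ j, ‖A₂ i j‖ ^ 2 := by
  set Q : Matrix r₁ r₁ ℂ := 1 + (ρ : ℂ) • (A₁ * A₁ᴴ) with hQ
  set R : Matrix r₁ r₂ ℂ := (ρ : ℂ) • (A₁ * A₂ᴴ) with hR
  set S : Matrix r₂ r₂ ℂ := (ρ : ℂ) • (A₂ * A₂ᴴ) with hS
  have hA₁ := posSemidef_smul_mul_conjTranspose hρ A₁
  have hQpos : Q.PosDef := Matrix.PosDef.one.add_posSemidef hA₁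
  let _ : Invertible Q := hQpos.isUnit.invertible
  have hRH : Rᴴ = (ρ : ℂ) • (A₂ * A₁ᴴ) := by
    rw [hR, Matrix.conjTranspose_smul, Matrix.conjTranspose_mul, Matrix.conjTranspose_conjTranspose]
    simp
  have hgram : (ρ : ℂ) • (Matrix.fromRows A₁ A₂ * (Matrix.fromRows A₁ A₂)ᴴ)
      = Matrix.fromBlocks ((ρ : ℂ) • (A₁ * A₁ᴴ)) R Rᴴ S := by
    rw [hRH, Matrix.conjTranspose_fromRows_eq_fromCols_conjTranspose, Matrix.fromRows_mul_fromCols,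
      Matrix.fromBlocks_smul]
  -- `Q` exceeds the corner of the Gram matrix by `I`, so the blocks `Q, R, R*, S` still form a
  -- positive semidefinite matrix, whose Schur complement is therefore positive semidefinite.
  have hX : (S - Rᴴ * Q⁻¹ * R).PosSemidef := by
    rw [← Matrix.PosDef.fromBlocks₁₁ R S hQpos]
    have h1 : (Matrix.fromBlocks (1 : Matrix r₁ r₁ ℂ) 0 0 (0 : Matrix r₂ r₂ ℂ)).PosSemidef := by
      have h := Matrix.posSemidef_self_mul_conjTranspose
        (Matrix.fromRows (1 : Matrix r₁ r₁ ℂ) (0 : Matrix r₂ r₁ ℂ))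
      rw [Matrix.conjTranspose_fromRows_eq_fromCols_conjTranspose, Matrix.fromRows_mul_fromCols]
        at h
      simpa using h
    have h2 := posSemidef_smul_mul_conjTranspose hρ (Matrix.fromRows A₁ A₂)
    rw [hgram] at h2
    have h3 := h1.add h2
    rw [Matrix.fromBlocks_add] at h3
    rwa [zero_add, zero_add, zero_add] at h3
  have hdet : (1 + (ρ : ℂ) • (Matrix.fromRows A₁ A₂ * (Matrix.fromRows A₁ A₂)ᴴ)).det
      = Q.det * (1 + (S - Rᴴ * Q⁻¹ * R)).det := by
    rw [hgram, ← Matrix.fromBlocks_one, Matrix.fromBlocks_add, zero_add, zero_add,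
      Matrix.det_fromBlocks₁₁, Matrix.invOf_eq_nonsing_inv, add_sub_assoc]
  have hQ1 : 1 ≤ Q.det.re := one_le_re_det_one_add hA₁
  have hX1 := one_le_re_det_one_add hX
  have hlog : logDet ρ (Matrix.fromRows A₁ A₂)
      = logDet ρ A₁ + Real.log (1 + (S - Rᴴ * Q⁻¹ * R)).det.re := by
    rw [logDet, hdet, Complex.mul_re, im_det_one_add hA₁, zero_mul, sub_zero,
      Real.log_mul (by linarith) (by linarith), logDet]
  have hle : (S - Rᴴ * Q⁻¹ * R).trace.re ≤ S.trace.re := by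
    have h := (hQpos.inv.posSemidef.conjTranspose_mul_mul_same R).trace_nonneg
    rw [Matrix.trace_sub, Complex.sub_re]
    have := (Complex.le_def.1 h).1
    simp only [Complex.zero_re] at this
    linarith
  have hStr : S.trace.re = ρ * ∑ i, ∑ j, ‖A₂ i j‖ ^ 2 := by
    rw [hS, Matrix.trace_smul, smul_eq_mul, Complex.re_ofReal_mul, re_trace_mul_conjTranspose]
  have hl1 := Real.log_nonneg hX1
  have hl2 := log_re_det_one_add_le_trace hX
  rw [hlog]
  constructor <;> linarith

/-- `logDet_fromRows` up to a permutation of the rows: the maps `f₁` and `f₂` enumerate the rows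
that are kept and those that are deleted. -/
lemma logDet_delete_rows {ρ : ℝ} (hρ : 0 < ρ) (A : Matrix r c ℂ) (f₁ : r₁ → r) (f₂ : r₂ → r)
    (hf : Function.Bijective (Sum.elim f₁ f₂)) :
    logDet ρ (A.submatrix f₁ id) ≤ logDet ρ A ∧
      logDet ρ A ≤ logDet ρ (A.submatrix f₁ id) + ρ * ∑ i, ∑ j, ‖A (f₂ i) j‖ ^ 2 := by
  have h : A.submatrix (Equiv.ofBijective _ hf) (Equiv.refl c)
      = Matrix.fromRows (A.submatrix f₁ id) (A.submatrix f₂ id) := by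
    ext (i | i) j <;> rfl
  rw [← logDet_submatrix_equiv ρ A (Equiv.ofBijective _ hf) (Equiv.refl c), h]
  exact logDet_fromRows hρ _ _

end Determinant

/-! ### Birkhoff's ergodic theorem -/

section ErgodicTheorem

variable {X : Type*} [MeasurableSpace X] {μ : Measure X} {T : X → X}

lemma integral_comp_of_measurePreserving (hT : MeasurePreserving T μ μ) {f : X → ℝ}
    (hf : Measurable f) : ∫ x, f (T x) ∂μ = ∫ x, f x ∂μ := by
  have h := integral_map (μ := μ) hT.measurable.aemeasurable
    (f := f) hf.aestronglyMeasurable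
  rw [hT.map_eq] at h
  exact h.symm

/-- The running maximum `max (0, S₁ f, …, S_n f)` of the Birkhoff sums `S_k f`, given by its
recursion along the orbit. -/
def maxBirkhoffSum (T : X → X) (f : X → ℝ) : ℕ → X → ℝ
  | 0, _ => 0
  | n + 1, x => max 0 (f x + maxBirkhoffSum T f n (T x))

omit [MeasurableSpace X] in
lemma maxBirkhoffSum_nonneg (T : X → X) (f : X → ℝ) (n : ℕ) (x : X) :
    0 ≤ maxBirkhoffSum T f n x := by
  cases n with
  | zero => exact le_rfl
  | succ n => exact le_max_left _ _

omit [MeasurableSpace X] in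
lemma maxBirkhoffSum_le_succ (T : X → X) (f : X → ℝ) (n : ℕ) (x : X) :
    maxBirkhoffSum T f n x ≤ maxBirkhoffSum T f (n + 1) x := by
  induction n generalizing x with
  | zero => exact le_max_left _ _
  | succ n ih => exact max_le_max le_rfl (add_le_add le_rfl (ih (T x)))

omit [MeasurableSpace X] in
lemma birkhoffSum_le_maxBirkhoffSum (T : X → X) (f : X → ℝ) (n : ℕ) (x : X) :
    birkhoffSum T f n x ≤ maxBirkhoffSum T f n x := by
  induction n generalizing x with
  | zero => simp [maxBirkhoffSum]
  | succ n ih =>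
    rw [birkhoffSum_succ']
    exact le_max_of_le_right (add_le_add le_rfl (ih (T x)))

lemma measurable_maxBirkhoffSum (hT : Measurable T) {f : X → ℝ} (hf : Measurable f) (n : ℕ) :
    Measurable (maxBirkhoffSum T f n) := by
  induction n with
  | zero => exact measurable_const
  | succ n ih => exact measurable_const.max (hf.add (ih.comp hT))

lemma integrable_maxBirkhoffSum (hT : MeasurePreserving T μ μ) {f : X → ℝ}
    (hfi : Integrable f μ) (n : ℕ) : Integrable (maxBirkhoffSum T f n) μ := by
  induction n with
  | zero => exact integrable_zero _ _ _
  | succ n ih =>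
    exact (integrable_zero _ _ _).sup (hfi.add (hT.integrable_comp_of_integrable ih))

/-- If the space average of `f` is negative then almost every orbit has Birkhoff sums that are
bounded above. Otherwise, by ergodicity, the running maxima `M_n` increase to infinity almost
everywhere, so that `M_{n+1} - M_n ∘ T` converges to `f`; as these differences have nonnegative
integrals, so would `f`. -/
lemma ae_bddAbove_birkhoffSum (hT : Ergodic T μ) {f : X → ℝ} (hf : Measurable f)
    (hfi : Integrable f μ) (hneg : ∫ x, f x ∂μ < 0) :
    ∀ᵐ x ∂μ, BddAbove (Set.range fun n => birkhoffSum T f n x) := by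
  have hM := measurable_maxBirkhoffSum hT.measurable hf
  have hMi := integrable_maxBirkhoffSum hT.toMeasurePreserving hfi
  set A : Set X := {x | BddAbove (Set.range fun n => maxBirkhoffSum T f n x)} with hA
  have hAm : MeasurableSet A := measurableSet_bddAbove_range hM
  have hAinv : T ⁻¹' A = A := by
    ext x
    simp only [hA, Set.mem_preimage, Set.mem_ofPred_eq]
    constructor
    · rintro ⟨C, hC⟩
      refine ⟨max 0 (f x + C), ?_⟩
      rintro _ ⟨n, rfl⟩
      cases n with
      | zero => exact le_max_left _ _
      | succ n => exact max_le_max le_rfl (add_le_add le_rfl (hC ⟨n, rfl⟩))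
    · rintro ⟨C, hC⟩
      refine ⟨C - f x, ?_⟩
      rintro _ ⟨n, rfl⟩
      have h1 : f x + maxBirkhoffSum T f n (T x) ≤ maxBirkhoffSum T f (n + 1) x := le_max_right _ _
      have h2 : maxBirkhoffSum T f (n + 1) x ≤ C := hC ⟨n + 1, rfl⟩
      show maxBirkhoffSum T f n (T x) ≤ C - f x
      linarith
  rcases hT.toPreErgodic.ae_mem_or_ae_notMem hAm hAinv with h | h
  · filter_upwards [h] with x ⟨C, hC⟩
    refine ⟨C, ?_⟩
    rintro _ ⟨n, rfl⟩
    exact (birkhoffSum_le_maxBirkhoffSum T f n x).trans (hC ⟨n, rfl⟩)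
  · exfalso
    set D : ℕ → X → ℝ := fun n x => maxBirkhoffSum T f (n + 1) x - maxBirkhoffSum T f n (T x)
      with hD
    have hDm : ∀ n, Measurable (D n) := fun n => (hM (n + 1)).sub ((hM n).comp hT.measurable)
    have hDnonneg : ∀ n, 0 ≤ ∫ x, D n x ∂μ := by
      intro n
      have hc : Integrable (fun x => maxBirkhoffSum T f n (T x)) μ :=
        hT.toMeasurePreserving.integrable_comp_of_integrable (hMi n)
      simp only [hD]
      rw [integral_sub (hMi _) hc,
        integral_comp_of_measurePreserving hT.toMeasurePreserving (hM n), sub_nonneg]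
      exact integral_mono (hMi n) (hMi (n + 1)) (maxBirkhoffSum_le_succ T f n)
    have hDbound : ∀ n, ∀ᵐ x ∂μ, ‖D n x‖ ≤ ‖f x‖ := by
      refine fun n => Eventually.of_forall fun x => ?_
      have h0 := maxBirkhoffSum_nonneg T f n (T x)
      simp only [hD, maxBirkhoffSum, Real.norm_eq_abs]
      rcases max_cases 0 (f x + maxBirkhoffSum T f n (T x)) with ⟨h1, h2⟩ | ⟨h1, h2⟩ <;> rw [h1]
      · rw [abs_le]
        constructor <;> linarith [neg_abs_le (f x), abs_nonneg (f x)]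
      · rw [add_sub_cancel_right]
    have hDlim : ∀ᵐ x ∂μ, Tendsto (fun n => D n x) atTop (𝓝 (f x)) := by
      filter_upwards [h] with x hx
      have hTx : T x ∉ A := by
        rw [← Set.mem_preimage, hAinv]
        exact hx
      have hmono : Monotone fun n => maxBirkhoffSum T f n (T x) :=
        monotone_nat_of_le_succ fun n => maxBirkhoffSum_le_succ T f n (T x)
      have hlim : Tendsto (fun n => maxBirkhoffSum T f n (T x)) atTop atTop :=
        tendsto_atTop_atTop_of_monotone' hmono hTx
      refine tendsto_const_nhds.congr' ?_
      filter_upwards [hlim.eventually_ge_atTop (-f x)] with n hn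
      simp only [hD, maxBirkhoffSum]
      rw [max_eq_right (by linarith), add_sub_cancel_right]
    have := tendsto_integral_of_dominated_convergence (fun x => ‖f x‖)
      (fun n => (hDm n).aestronglyMeasurable) hfi.norm hDbound hDlim
    exact absurd (ge_of_tendsto' this hDnonneg) (not_le.2 hneg)

/-- **Birkhoff's pointwise ergodic theorem** for an ergodic transformation. -/
theorem tendsto_birkhoffSum_div [IsProbabilityMeasure μ] (hT : Ergodic T μ) {f : X → ℝ}
    (hf : Measurable f) (hfi : Integrable f μ) :
    ∀ᵐ x ∂μ, Tendsto (fun n : ℕ => birkhoffSum T f n x / n) atTop (𝓝 (∫ x, f x ∂μ)) := by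
  -- The upper bound for `h`; applied to both `f` and `-f` it gives the two-sided limit.
  have key : ∀ {h : X → ℝ}, Measurable h → Integrable h μ →
      ∀ᵐ x ∂μ, ∀ k : ℕ, ∃ C, ∀ n : ℕ,
        birkhoffSum T h n x ≤ C + n * ((∫ x, h x ∂μ) + 1 / ((k : ℝ) + 1)) := by
    intro h hh hhi
    refine ae_all_iff.2 fun k => ?_
    set b : ℝ := (∫ x, h x ∂μ) + 1 / ((k : ℝ) + 1) with hb
    have hneg : ∫ x, (h x - b) ∂μ < 0 := by
      have : (0 : ℝ) < 1 / ((k : ℝ) + 1) := by positivity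
      rw [integral_sub hhi (integrable_const b)]
      simp only [integral_const, probReal_univ, one_smul]
      linarith
    filter_upwards [ae_bddAbove_birkhoffSum hT (hh.sub_const b) (hhi.sub (integrable_const b)) hneg]
      with x ⟨C, hC⟩
    refine ⟨C, fun n => ?_⟩
    have h1 : birkhoffSum T (fun x => h x - b) n x ≤ C := hC ⟨n, rfl⟩
    simp only [birkhoffSum, Finset.sum_sub_distrib, Finset.sum_const, Finset.card_range,
      nsmul_eq_mul] at h1 ⊢
    linarith
  filter_upwards [key hf hfi, key hf.neg hfi.neg] with x h1 h2
  rw [Metric.tendsto_atTop]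
  intro ε hε
  obtain ⟨k, hk⟩ := exists_nat_one_div_lt (half_pos hε)
  obtain ⟨C₁, hC₁⟩ := h1 k
  obtain ⟨C₂, hC₂⟩ := h2 k
  obtain ⟨n₀, hn₀⟩ := exists_nat_gt (max C₁ C₂ / (ε / 2))
  refine ⟨n₀ + 1, fun n hn => ?_⟩
  have hn' : (n₀ : ℝ) + 1 ≤ n := by exact_mod_cast hn
  have hnpos : (0 : ℝ) < n := by
    have : (0 : ℝ) ≤ n₀ := n₀.cast_nonneg
    linarith
  rw [div_lt_iff₀ (half_pos hε)] at hn₀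
  have hmax : max C₁ C₂ < n * (ε / 2) :=
    hn₀.trans (mul_lt_mul_of_pos_right (by linarith) (half_pos hε))
  have hk' : n * (1 / ((k : ℝ) + 1)) < n * (ε / 2) := mul_lt_mul_of_pos_left hk hnpos
  have e1 := hC₁ n
  have e2 := hC₂ n
  have hm1 := le_max_left C₁ C₂
  have hm2 := le_max_right C₁ C₂
  simp only [Pi.neg_apply, integral_neg] at e2
  have e3 : birkhoffSum T (-f) n x = - birkhoffSum T f n x := by
    simp [birkhoffSum, Finset.sum_neg_distrib]
  rw [e3] at e2
  rw [Real.dist_eq, div_sub' hnpos.ne', abs_div, abs_of_pos hnpos, div_lt_iff₀ hnpos, abs_lt]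
  constructor <;> nlinarith

lemma tendsto_iterate_div [IsProbabilityMeasure μ] (hT : Ergodic T μ) {f : X → ℝ}
    (hf : Measurable f) (hfi : Integrable f μ) :
    ∀ᵐ x ∂μ, Tendsto (fun n : ℕ => f (T^[n] x) / n) atTop (𝓝 0) := by
  filter_upwards [tendsto_birkhoffSum_div hT hf hfi] with x hx
  have h1 : Tendsto (fun n : ℕ => ((n : ℝ) + 1) / n) atTop (𝓝 1) := by
    have := (tendsto_one_div_atTop_nhds_zero_nat (𝕜 := ℝ)).const_add 1
    rw [add_zero] at this
    refine this.congr' ?_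
    filter_upwards [eventually_ne_atTop 0] with n hn
    have : (n : ℝ) ≠ 0 := by exact_mod_cast hn
    field_simp
  have h2 := ((hx.comp (tendsto_add_atTop_nat 1)).mul h1).sub hx
  rw [mul_one, sub_self] at h2
  refine h2.congr fun n => ?_
  have : (n : ℝ) + 1 ≠ 0 := by positivity
  simp only [Function.comp, birkhoffSum_succ, Nat.cast_add, Nat.cast_one]
  field_simp
  ring

end ErgodicTheorem

/-! ### Almost additive sequences -/

section AlmostAdditive

/-- Fekete's lemma with an error estimate: `a + e` and `e - a` are both subadditive. -/
lemma exists_abs_sub_mul_le {a : ℕ → ℝ} {e : ℝ} (h : ∀ m n, |a (m + n) - a m - a n| ≤ e) :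
    ∃ I : ℝ, ∀ n : ℕ, |a n - n * I| ≤ e := by
  have hu : Subadditive fun n => a n + e := fun m n => by
    have := (abs_le.1 (h m n)).2
    linarith
  have hv : Subadditive fun n => e - a n := fun m n => by
    have := (abs_le.1 (h m n)).1
    linarith
  have he : 0 ≤ e := (abs_nonneg _).trans (h 0 0)
  have hlin : ∀ n : ℕ, |a n - n * a 1| ≤ ((n : ℝ) + 1) * e := by
    intro n
    induction n with
    | zero =>
      have := h 0 0
      rw [abs_le] at this ⊢
      norm_num at this ⊢
      constructor <;> linarith [this.1, this.2]
    | succ n ih =>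
      have := h n 1
      rw [abs_le] at ih this ⊢
      push_cast
      constructor <;> nlinarith [ih.1, ih.2, this.1, this.2]
  have hbdd : ∀ {b : ℕ → ℝ} {c : ℝ}, (∀ n : ℕ, -(n * c) ≤ b n) → 0 ≤ c →
      BddBelow (Set.range fun n : ℕ => b n / n) := by
    intro b c hb hc
    refine ⟨-c, ?_⟩
    rintro _ ⟨n, rfl⟩
    rcases Nat.eq_zero_or_pos n with rfl | hn
    · simpa using hc
    · have hn' : (0 : ℝ) < n := by exact_mod_cast hn
      show -c ≤ b n / n
      rw [le_div_iff₀ hn']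
      linarith [hb n]
  have hub := hbdd (b := fun n => a n + e) (c := |a 1| + e) (fun n => by
    have h1 := (abs_le.1 (hlin n)).1
    have h2 : -(n * |a 1|) ≤ n * a 1 := by
      rw [← mul_neg]; exact mul_le_mul_of_nonneg_left (neg_abs_le _) n.cast_nonneg
    linarith) (by positivity)
  have hvb := hbdd (b := fun n => e - a n) (c := |a 1| + e) (fun n => by
    have h1 := (abs_le.1 (hlin n)).2
    have h2 : n * a 1 ≤ n * |a 1| := mul_le_mul_of_nonneg_left (le_abs_self _) n.cast_nonneg
    linarith) (by positivity)
  have hsum : hu.lim + hv.lim = 0 := by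
    have h1 := (hu.tendsto_lim hub).add (hv.tendsto_lim hvb)
    have h2 : Tendsto (fun n : ℕ => 2 * e / (n : ℝ)) atTop (𝓝 0) :=
      tendsto_const_div_atTop_nhds_zero_nat _
    refine tendsto_nhds_unique (h1.congr fun n => ?_) h2
    ring
  refine ⟨hu.lim, fun n => ?_⟩
  rcases Nat.eq_zero_or_pos n with rfl | hn
  · have := h 0 0
    rw [abs_le] at this ⊢
    norm_num at this ⊢
    constructor <;> linarith [this.1, this.2]
  · have hn' : (0 : ℝ) < n := by exact_mod_cast hn
    have h1 := hu.lim_le_div hub hn.ne'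
    have h2 := hv.lim_le_div hvb hn.ne'
    rw [le_div_iff₀ hn'] at h1 h2
    rw [abs_le]
    constructor <;> nlinarith

lemma sum_range_shift_sub (g : ℕ → ℝ) (q n : ℕ) :
    ∑ i ∈ Finset.range n, (g (i + q) - g i) = ∑ i ∈ Finset.range q, (g (n + i) - g i) := by
  induction n with
  | zero => simp
  | succ n ih =>
    have h := Finset.sum_range_succ (fun i => g (n + i)) q
    rw [Finset.sum_range_succ' (fun i => g (n + i)) q] at h
    have h' : ∀ i, n + 1 + i = n + (i + 1) := fun i => by ring
    rw [Finset.sum_range_succ, ih, Finset.sum_sub_distrib, Finset.sum_sub_distrib]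
    simp only [h']
    simp only [add_zero] at h
    linarith

variable {X : Type*} [MeasurableSpace X] {μ : Measure X} {T : X → X}

omit [MeasurableSpace X] in
/-- Along a single orbit, an almost additive sequence is compared with the Birkhoff sums of its
`q`-th member: the differences `g_{i+q} - g_i` telescope. -/
lemma abs_mul_sub_birkhoffSum_le {g : ℕ → X → ℝ} {s : X → ℝ}
    (h : ∀ m n x, |g (m + n) x - g m x - g n (T^[m] x)| ≤ s (T^[m] x)) (q n : ℕ) (x : X) :
    |q * g n x - birkhoffSum T (g q) n x| ≤ birkhoffSum T s n x + q * s (T^[n] x)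
      + ∑ i ∈ Finset.range q, (|g i (T^[n] x)| + |g i x|) := by
  have h1 : |∑ i ∈ Finset.range n, (g (i + q) x - g i x - g q (T^[i] x))|
      ≤ birkhoffSum T s n x :=
    (Finset.abs_sum_le_sum_abs _ _).trans (Finset.sum_le_sum fun i _ => h i q x)
  rw [Finset.sum_sub_distrib, sum_range_shift_sub fun i => g i x] at h1
  have h2 : |∑ i ∈ Finset.range q, (g (n + i) x - g n x - g i (T^[n] x))| ≤ q * s (T^[n] x) := by
    refine (Finset.abs_sum_le_sum_abs _ _).trans
      ((Finset.sum_le_sum fun i _ => h n i x).trans ?_)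
    simp
  -- What is left of the telescoping sum at its two ends.
  have h3 : |∑ i ∈ Finset.range q, (g i (T^[n] x) - g i x)|
      ≤ ∑ i ∈ Finset.range q, (|g i (T^[n] x)| + |g i x|) :=
    (Finset.abs_sum_le_sum_abs _ _).trans (Finset.sum_le_sum fun i _ => abs_sub _ _)
  simp only [Finset.sum_sub_distrib, Finset.sum_const, Finset.card_range, nsmul_eq_mul] at h1 h2 h3
  rw [abs_le] at h1 h2 h3 ⊢
  simp only [birkhoffSum] at h1 ⊢
  constructor <;> linarith [h1.1, h1.2, h2.1, h2.2, h3.1, h3.2]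

lemma abs_integral_almost_additive_le (hT : MeasurePreserving T μ μ) {g : ℕ → X → ℝ} {s : X → ℝ}
    (hg : ∀ n, Measurable (g n)) (hgi : ∀ n, Integrable (g n) μ) (hs : Measurable s)
    (hsi : Integrable s μ)
    (h : ∀ m n x, |g (m + n) x - g m x - g n (T^[m] x)| ≤ s (T^[m] x)) (m n : ℕ) :
    |(∫ x, g (m + n) x ∂μ) - (∫ x, g m x ∂μ) - ∫ x, g n x ∂μ| ≤ ∫ x, s x ∂μ := by
  have hTm := hT.iterate m
  have hc : Integrable (fun x => g n (T^[m] x)) μ := hTm.integrable_comp_of_integrable (hgi n)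
  have hd : Integrable (fun x => g (m + n) x - g m x) μ := (hgi _).sub (hgi _)
  rw [← integral_comp_of_measurePreserving hTm (hg n),
    ← integral_comp_of_measurePreserving hTm hs, ← integral_sub (hgi _) (hgi _),
    ← integral_sub hd hc]
  refine (abs_integral_le_integral_abs).trans ?_
  exact integral_mono (hd.sub hc).abs (hTm.integrable_comp_of_integrable hsi)
    (h m n)

/-- The ergodic theorem for almost additive sequences: `g n / n` is within `2 E s / q` of `I` in the
limit, for every `q`. -/
theorem tendsto_almost_additive_div [IsProbabilityMeasure μ] (hT : Ergodic T μ)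
    {g : ℕ → X → ℝ} {s : X → ℝ}
    (hg : ∀ n, Measurable (g n)) (hgi : ∀ n, Integrable (g n) μ) (hs : Measurable s)
    (hsi : Integrable s μ)
    (h : ∀ m n x, |g (m + n) x - g m x - g n (T^[m] x)| ≤ s (T^[m] x)) {I : ℝ}
    (hI : ∀ n : ℕ, |(∫ x, g n x ∂μ) - n * I| ≤ ∫ x, s x ∂μ) :
    ∀ᵐ x ∂μ, Tendsto (fun n : ℕ => g n x / n) atTop (𝓝 I) := by
  have H1 := ae_all_iff.2 fun q => tendsto_birkhoffSum_div hT (hg q) (hgi q)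
  have H2 := ae_all_iff.2 fun q => tendsto_iterate_div hT (hg q) (hgi q)
  filter_upwards [H1, H2, tendsto_birkhoffSum_div hT hs hsi, tendsto_iterate_div hT hs hsi]
    with x h1 h2 h3 h4
  set e := ∫ x, s x ∂μ with he
  have he0 : 0 ≤ e := (abs_nonneg _).trans (hI 0)
  rw [Metric.tendsto_atTop]
  intro ε hε
  obtain ⟨q₀, hq₀⟩ := exists_nat_gt (2 * e / ε)
  rw [div_lt_iff₀ hε] at hq₀
  -- The rate of `g q` and the Birkhoff averages of `s` each cost `e`, to be divided by `q`.
  set q := q₀ + 1 with hq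
  have hqc : (q : ℝ) = q₀ + 1 := by simp [hq]
  have hqpos : (0 : ℝ) < q := by positivity
  have hqe : 2 * e < q * ε := by rw [hqc]; linarith
  have hlim : Tendsto (fun n : ℕ => |birkhoffSum T (g q) n x / n - ∫ x, g q x ∂μ| + e
      + birkhoffSum T s n x / n + q * (s (T^[n] x) / n)
      + ∑ i ∈ Finset.range q, (|g i (T^[n] x) / n| + |g i x| / n)) atTop
      (𝓝 (|(∫ x, g q x ∂μ) - ∫ x, g q x ∂μ| + e + e + q * 0
        + ∑ i ∈ Finset.range q, (|(0 : ℝ)| + 0))) := by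
    refine (((((h1 q).sub_const _).abs.add_const e).add h3).add (h4.const_mul _)).add ?_
    exact tendsto_finsetSum _ fun i _ =>
      (h2 i).abs.add (tendsto_const_div_atTop_nhds_zero_nat _)
  have hlim' := hlim.eventually_lt_const (u := q * ε) (by simpa [two_mul] using hqe)
  obtain ⟨n₀, hn₀⟩ := eventually_atTop.1 (hlim'.and (eventually_gt_atTop 0))
  refine ⟨n₀, fun n hn => ?_⟩
  obtain ⟨hlt, hn1⟩ := hn₀ n hn
  have hnpos : (0 : ℝ) < n := by exact_mod_cast hn1
  have hmain : |(q : ℝ) * (g n x / n - I)| ≤ |birkhoffSum T (g q) n x / n - ∫ x, g q x ∂μ| + e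
      + birkhoffSum T s n x / n + q * (s (T^[n] x) / n)
      + ∑ i ∈ Finset.range q, (|g i (T^[n] x) / n| + |g i x| / n) := by
    have e1 : (q : ℝ) * (g n x / n - I) = (birkhoffSum T (g q) n x / n - ∫ x, g q x ∂μ)
        + ((∫ x, g q x ∂μ) - q * I) + (q * g n x - birkhoffSum T (g q) n x) / n := by
      field_simp
      ring
    have e2 : |(q * g n x - birkhoffSum T (g q) n x) / n| ≤ birkhoffSum T s n x / n
        + q * (s (T^[n] x) / n) + ∑ i ∈ Finset.range q, (|g i (T^[n] x) / n| + |g i x| / n) := by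
      rw [abs_div, abs_of_pos hnpos, div_le_iff₀ hnpos]
      refine (abs_mul_sub_birkhoffSum_le h q n x).trans (le_of_eq ?_)
      rw [add_mul, add_mul, Finset.sum_mul]
      congr 1
      · field_simp
      · refine Finset.sum_congr rfl fun i _ => ?_
        rw [abs_div, abs_of_pos hnpos]
        field_simp
    rw [e1]
    refine (abs_add_three _ _ _).trans ?_
    linarith [hI q]
  rw [Real.dist_eq]
  rw [abs_mul, abs_of_pos hqpos] at hmain
  exact lt_of_mul_lt_mul_left (hmain.trans_lt hlt) hqpos.le

end AlmostAdditive

/-! ### Band matrices and their circularization -/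

section BandMatrix

variable {N K : ℕ}

/-- The sum of the squared moduli of the entries of the pair `(A, B)`. -/
def energy (A B : Matrix (Fin N) (Fin K) ℂ) : ℝ :=
  ∑ i, ∑ j, (‖A i j‖ ^ 2 + ‖B i j‖ ^ 2)

lemma energy_nonneg (A B : Matrix (Fin N) (Fin K) ℂ) : 0 ≤ energy A B :=
  Finset.sum_nonneg fun _ _ => Finset.sum_nonneg fun _ _ => by positivity

/-- Apply `A` to the conjugate of its `i`-th row. -/
lemma sum_norm_sq_row_le (A : Matrix (Fin N) (Fin K) ℂ) (i : Fin N) :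
    ∑ j, ‖A i j‖ ^ 2 ≤ specNorm A ^ 2 := by
  set t : ℝ := ∑ j, ‖A i j‖ ^ 2 with ht
  set v : EuclideanSpace ℂ (Fin K) := WithLp.toLp 2 fun j => star (A i j) with hv
  have hvn : ‖v‖ ^ 2 = t := by
    rw [EuclideanSpace.norm_sq_eq]
    simp [hv, ht]
  have hAv : (Matrix.toEuclideanLin A v) i = (t : ℂ) := by
    simp only [Matrix.toLpLin_apply, hv, Matrix.mulVec, dotProduct, ht]
    push_cast
    refine Finset.sum_congr rfl fun j _ => ?_
    rw [Complex.star_def, Complex.mul_conj, Complex.normSq_eq_norm_sq]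
    push_cast
    rfl
  have h1 : t ≤ ‖Matrix.toEuclideanLin A v‖ := by
    have := PiLp.norm_apply_le (Matrix.toEuclideanLin A v) i
    rw [hAv, Complex.norm_real] at this
    exact (le_abs_self t).trans this
  have h2 : ‖Matrix.toEuclideanLin A v‖ ≤ specNorm A * ‖v‖ :=
    (LinearMap.toContinuousLinearMap (Matrix.toEuclideanLin A)).le_opNorm v
  have hs : 0 ≤ specNorm A := norm_nonneg _
  rcases (norm_nonneg v).eq_or_lt with h0 | h0
  · rw [← hvn, ← h0]
    nlinarith
  · have h3 : ‖v‖ * ‖v‖ ≤ specNorm A * ‖v‖ := by nlinarith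
    have h4 : ‖v‖ ≤ specNorm A := le_of_mul_le_mul_right h3 h0
    rw [← hvn]
    nlinarith

lemma energy_le (A B : Matrix (Fin N) (Fin K) ℂ) :
    energy A B ≤ N * (specNorm A ^ 2 + specNorm B ^ 2) := by
  have : ∑ _i : Fin N, (specNorm A ^ 2 + specNorm B ^ 2)
      = N * (specNorm A ^ 2 + specNorm B ^ 2) := by simp [mul_add]
  rw [← this]
  refine Finset.sum_le_sum fun i _ => ?_
  rw [Finset.sum_add_distrib]
  exact add_le_add (sum_norm_sq_row_le A i) (sum_norm_sq_row_le B i)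

lemma sum_norm_sq_two_blocks {S : Finset ℤ} {k l : ℤ} (hk : k ∈ S) (hl : l ∈ S) (hkl : l ≠ k)
    (u v : Fin K → ℂ) :
    ∑ j : S × Fin K,
      ‖if (j.1 : ℤ) = k then u j.2 else if (j.1 : ℤ) = l then v j.2 else 0‖ ^ 2
      = ∑ j, (‖v j‖ ^ 2 + ‖u j‖ ^ 2) := by
  rw [Fintype.sum_prod_type_right]
  refine Finset.sum_congr rfl fun j _ => ?_
  have h : ∀ a : S, ‖if (a : ℤ) = k then u j else if (a : ℤ) = l then v j else 0‖ ^ 2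
      = (if (a : ℤ) = l then ‖v j‖ ^ 2 else 0) + if (a : ℤ) = k then ‖u j‖ ^ 2 else 0 := by
    intro a
    by_cases h1 : (a : ℤ) = k
    · have h2 : (a : ℤ) ≠ l := fun h2 => hkl (h2.symm.trans h1)
      simp [h1, hkl.symm]
    · by_cases h2 : (a : ℤ) = l <;> simp [h1, h2, hkl]
  rw [Finset.sum_congr rfl fun a _ => h a, Finset.sum_add_distrib,
    Finset.sum_coe_sort S fun a => if a = l then ‖v j‖ ^ 2 else 0,
    Finset.sum_coe_sort S fun a => if a = k then ‖u j‖ ^ 2 else 0,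
    Finset.sum_ite_eq', Finset.sum_ite_eq', if_pos hk, if_pos hl]

/-- Translation by `c` as a bijection between integer intervals. -/
def iccShift {m n m' n' : ℤ} (c : ℤ) (hm : m' = m + c) (hn : n' = n + c) :
    Finset.Icc m n ≃ Finset.Icc m' n' where
  toFun a := ⟨a + c, by have := Finset.mem_Icc.1 a.2; rw [Finset.mem_Icc]; omega⟩
  invFun a := ⟨a - c, by have := Finset.mem_Icc.1 a.2; rw [Finset.mem_Icc]; omega⟩
  left_inv a := by ext; simp
  right_inv a := by ext; simp

/-- The inclusion of integer intervals. -/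
def iccIncl {m n m' n' : ℤ} (hm : m' ≤ m) (hn : n ≤ n') (a : Finset.Icc m n) :
    Finset.Icc m' n' :=
  ⟨a, by have := Finset.mem_Icc.1 a.2; rw [Finset.mem_Icc]; omega⟩

variable (F G : ℤ → Matrix (Fin N) (Fin K) ℂ)

lemma logDet_bandMatrix_shift (ρ : ℝ) (m n c : ℤ) :
    logDet ρ (bandMatrix (fun k => F (k + c)) (fun k => G (k + c)) m n)
      = logDet ρ (bandMatrix F G (m + c) (n + c)) := by
  rw [← logDet_submatrix_equiv ρ (bandMatrix F G (m + c) (n + c))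
    ((iccShift c rfl rfl).prodCongr (Equiv.refl (Fin N)))
    ((iccShift (m := m - 1) (n := n) c (by ring) rfl).prodCongr (Equiv.refl (Fin K)))]
  congr 1
  ext ⟨i, a⟩ ⟨j, b⟩
  have h : (j : ℤ) + c = (i : ℤ) + c - 1 ↔ (j : ℤ) = (i : ℤ) - 1 := by omega
  simp [bandMatrix, iccShift, h]

lemma logDet_bandMatrix_empty (ρ : ℝ) {m n : ℤ} (h : n < m) :
    logDet ρ (bandMatrix F G m n) = 0 := by
  have : IsEmpty (Finset.Icc m n × Fin N) := ⟨fun a => by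
    have := Finset.mem_Icc.1 a.1.2
    omega⟩
  rw [logDet, Matrix.det_isEmpty]
  simp

/-- Deleting block row `k` splits the band matrix into two independent band matrices. -/
lemma logDet_bandMatrix_delete {ρ : ℝ} (hρ : 0 < ρ) {m n k : ℤ} (hmk : m ≤ k) (hkn : k ≤ n) :
    logDet ρ (bandMatrix F G m (k - 1)) + logDet ρ (bandMatrix F G (k + 1) n)
        ≤ logDet ρ (bandMatrix F G m n) ∧
      logDet ρ (bandMatrix F G m n)
        ≤ logDet ρ (bandMatrix F G m (k - 1)) + logDet ρ (bandMatrix F G (k + 1) n)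
          + ρ * energy (F k) (G k) := by
  have hk : k ∈ Finset.Icc m n := Finset.mem_Icc.2 ⟨hmk, hkn⟩
  let f₁ : (Finset.Icc m (k - 1) × Fin N) ⊕ (Finset.Icc (k + 1) n × Fin N) →
      Finset.Icc m n × Fin N :=
    Sum.elim (Prod.map (iccIncl le_rfl (by omega)) id) (Prod.map (iccIncl (by omega) le_rfl) id)
  let f₂ : Fin N → Finset.Icc m n × Fin N := fun a => (⟨k, hk⟩, a)
  let g : (Finset.Icc (m - 1) (k - 1) × Fin K) ⊕ (Finset.Icc (k + 1 - 1) n × Fin K) →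
      Finset.Icc (m - 1) n × Fin K :=
    Sum.elim (Prod.map (iccIncl le_rfl (by omega)) id) (Prod.map (iccIncl (by omega) le_rfl) id)
  have hf : Function.Bijective (Sum.elim f₁ f₂) := by
    constructor
    · rintro ((⟨⟨i, hi⟩, a⟩ | ⟨⟨i, hi⟩, a⟩) | a) ((⟨⟨j, hj⟩, b⟩ | ⟨⟨j, hj⟩, b⟩) | b) h <;>
        simp [f₁, f₂, iccIncl] at h ⊢ <;>
        first | exact h | (simp only [Finset.mem_Icc] at *; omega)
    · rintro ⟨⟨i, hi⟩, a⟩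
      have hi' := Finset.mem_Icc.1 hi
      rcases lt_trichotomy i k with h | h | h
      · exact ⟨Sum.inl (Sum.inl (⟨i, Finset.mem_Icc.2 (by omega)⟩, a)), rfl⟩
      · subst h
        exact ⟨Sum.inr a, rfl⟩
      · exact ⟨Sum.inl (Sum.inr (⟨i, Finset.mem_Icc.2 (by omega)⟩, a)), rfl⟩
  have hg : Function.Bijective g := by
    constructor
    · rintro (⟨⟨i, hi⟩, a⟩ | ⟨⟨i, hi⟩, a⟩) (⟨⟨j, hj⟩, b⟩ | ⟨⟨j, hj⟩, b⟩) h <;>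
        simp [g, iccIncl] at h ⊢ <;>
        first | exact h | (simp only [Finset.mem_Icc] at *; omega)
    · rintro ⟨⟨i, hi⟩, a⟩
      have hi' := Finset.mem_Icc.1 hi
      rcases lt_or_ge i k with h | h
      · exact ⟨Sum.inl (⟨i, Finset.mem_Icc.2 (by omega)⟩, a), rfl⟩
      · exact ⟨Sum.inr (⟨i, Finset.mem_Icc.2 (by omega)⟩, a), rfl⟩
  have hblocks : ((bandMatrix F G m n).submatrix f₁ id).submatrix (Equiv.refl _)
      (Equiv.ofBijective g hg)
      = Matrix.fromBlocks (bandMatrix F G m (k - 1)) 0 0 (bandMatrix F G (k + 1) n) := by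
    ext (⟨⟨i, hi⟩, a⟩ | ⟨⟨i, hi⟩, a⟩) (⟨⟨j, hj⟩, b⟩ | ⟨⟨j, hj⟩, b⟩) <;>
      have hi' := Finset.mem_Icc.1 hi <;> have hj' := Finset.mem_Icc.1 hj
    · rfl
    · have h1 : j ≠ i := by omega
      have h2 : j ≠ i - 1 := by omega
      simp [bandMatrix, f₁, g, iccIncl, h1, h2]
    · have h1 : j ≠ i := by omega
      have h2 : j ≠ i - 1 := by omega
      simp [bandMatrix, f₁, g, iccIncl, h1, h2]
    · rfl
  have hrow : ∑ i, ∑ j, ‖bandMatrix F G m n (f₂ i) j‖ ^ 2 = energy (F k) (G k) := by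
    refine Finset.sum_congr rfl fun i _ => ?_
    exact sum_norm_sq_two_blocks (k := k) (l := k - 1) (Finset.mem_Icc.2 (by omega))
      (Finset.mem_Icc.2 (by omega)) (by omega) (G k i) (F k i)
  have h := logDet_delete_rows hρ (bandMatrix F G m n) f₁ f₂ hf
  rw [hrow, ← logDet_submatrix_equiv ρ ((bandMatrix F G m n).submatrix f₁ id) (Equiv.refl _)
    (Equiv.ofBijective g hg), hblocks, logDet_fromBlocks_diagonal hρ] at h
  exact h

lemma logDet_bandMatrix_delete_first {ρ : ℝ} (hρ : 0 < ρ) {m n : ℤ} (h : m ≤ n) :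
    logDet ρ (bandMatrix F G (m + 1) n) ≤ logDet ρ (bandMatrix F G m n) ∧
      logDet ρ (bandMatrix F G m n)
        ≤ logDet ρ (bandMatrix F G (m + 1) n) + ρ * energy (F m) (G m) := by
  have h1 := logDet_bandMatrix_delete F G hρ le_rfl h
  rwa [logDet_bandMatrix_empty F G ρ (show m - 1 < m by omega), zero_add] at h1

/-- Almost additivity of the log-determinant in the window. -/
lemma abs_logDet_bandMatrix_sub_le {ρ : ℝ} (hρ : 0 < ρ) {m n k : ℤ} (hmk : m ≤ k) (hkn : k ≤ n) :
    |logDet ρ (bandMatrix F G m n) - logDet ρ (bandMatrix F G m (k - 1))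
      - logDet ρ (bandMatrix F G k n)| ≤ ρ * energy (F k) (G k) := by
  have h1 := logDet_bandMatrix_delete F G hρ hmk hkn
  have h2 := logDet_bandMatrix_delete_first F G hρ hkn
  rw [abs_le]
  constructor <;> linarith [h1.1, h1.2, h2.1, h2.2]

/-- Deleting the first block row of the circularized matrix leaves a band matrix. -/
lemma logDet_circMatrix_delete_first {ρ : ℝ} (hρ : 0 < ρ) {m n : ℤ} (h : m < n) :
    logDet ρ (bandMatrix F G (m + 1) n) ≤ logDet ρ (circMatrix F G m n) ∧
      logDet ρ (circMatrix F G m n)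
        ≤ logDet ρ (bandMatrix F G (m + 1) n) + ρ * energy (F m) (G m) := by
  let f₁ : Finset.Icc (m + 1) n × Fin N → Finset.Icc m n × Fin N :=
    Prod.map (iccIncl (by omega) le_rfl) id
  let f₂ : Fin N → Finset.Icc m n × Fin N := fun a => (⟨m, Finset.mem_Icc.2 (by omega)⟩, a)
  have hf : Function.Bijective (Sum.elim f₁ f₂) := by
    constructor
    · rintro (⟨⟨i, hi⟩, a⟩ | a) (⟨⟨j, hj⟩, b⟩ | b) h <;>
        simp [f₁, f₂, iccIncl] at h ⊢ <;>
        first | exact h | (simp only [Finset.mem_Icc] at *; omega)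
    · rintro ⟨⟨i, hi⟩, a⟩
      have hi' := Finset.mem_Icc.1 hi
      rcases eq_or_ne i m with h | h
      · subst h
        exact ⟨Sum.inr a, rfl⟩
      · exact ⟨Sum.inl (⟨i, Finset.mem_Icc.2 (by omega)⟩, a), rfl⟩
  have hband : ((circMatrix F G m n).submatrix f₁ id).submatrix (Equiv.refl _)
      ((iccShift (m := m + 1 - 1) (n := n) 0 (by ring) (by ring)).prodCongr (Equiv.refl (Fin K)))
      = bandMatrix F G (m + 1) n := by
    ext ⟨⟨i, hi⟩, a⟩ ⟨⟨j, hj⟩, b⟩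
    have hi' := Finset.mem_Icc.1 hi
    have h1 : i ≠ m := by omega
    simp [circMatrix, bandMatrix, f₁, iccIncl, iccShift, h1]
  have hrow : ∑ i, ∑ j, ‖circMatrix F G m n (f₂ i) j‖ ^ 2 = energy (F m) (G m) := by
    refine Finset.sum_congr rfl fun i _ => ?_
    rw [← sum_norm_sq_two_blocks (S := Finset.Icc m n) (k := m) (l := n)
      (Finset.mem_Icc.2 (by omega)) (Finset.mem_Icc.2 (by omega)) h.ne' (G m i) (F m i)]
    refine Finset.sum_congr rfl fun ⟨⟨j, hj⟩, b⟩ _ => ?_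
    have hj' := Finset.mem_Icc.1 hj
    -- Block row `m` has no block in column `m - 1`, which lies outside of the matrix.
    have h1 : j ≠ m - 1 := by omega
    simp [circMatrix, f₂, h1]
  have h := logDet_delete_rows hρ (circMatrix F G m n) f₁ f₂ hf
  rw [hrow, ← logDet_submatrix_equiv ρ ((circMatrix F G m n).submatrix f₁ id) (Equiv.refl _)
    ((iccShift (m := m + 1 - 1) (n := n) 0 (by ring) (by ring)).prodCongr (Equiv.refl (Fin K))),
    hband] at h
  exact h

lemma abs_logDet_circMatrix_sub_bandMatrix_le {ρ : ℝ} (hρ : 0 < ρ) {m n : ℤ} (h : m < n) :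
    |logDet ρ (circMatrix F G m n) - logDet ρ (bandMatrix F G m n)|
      ≤ ρ * energy (F m) (G m) := by
  have h1 := logDet_circMatrix_delete_first F G hρ h
  have h2 := logDet_bandMatrix_delete_first F G hρ h.le
  rw [abs_le]
  constructor <;> linarith [h1.1, h1.2, h2.1, h2.2]

end BandMatrix

/-! ### Limits along windows -/

section WindowLimit

lemma exists_abs_sub_mul_le_of_tendsto {a : ℕ → ℝ} {J : ℝ}
    (ha : Tendsto (fun n : ℕ => a n / n) atTop (𝓝 J)) {ε : ℝ} (hε : 0 < ε) :
    ∃ C, 0 ≤ C ∧ ∀ n : ℕ, |a n - n * J| ≤ ε * n + C := by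
  obtain ⟨n₀, hn₀⟩ := Metric.tendsto_atTop.1 ha ε hε
  refine ⟨∑ i ∈ Finset.range (n₀ + 1), |a i - i * J|,
    Finset.sum_nonneg fun _ _ => abs_nonneg _, fun n => ?_⟩
  rcases lt_or_ge n (n₀ + 1) with h | h
  · have h1 := Finset.single_le_sum (f := fun i : ℕ => |a i - i * J|)
      (fun i _ => abs_nonneg _) (Finset.mem_range.2 h)
    have h2 : 0 ≤ ε * n := by positivity
    linarith
  · have hn : (0 : ℝ) < n := by
      have : 0 < n := by omega
      exact_mod_cast this
    have h1 := hn₀ n (by omega)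
    have h2 : 0 ≤ ∑ i ∈ Finset.range (n₀ + 1), |a i - i * J| :=
      Finset.sum_nonneg fun _ _ => abs_nonneg _
    rw [Real.dist_eq, div_sub' hn.ne', abs_div, abs_of_pos hn, div_lt_iff₀ hn] at h1
    linarith

/-- A function of windows `[m, n] ∋ c` that is up to a bounded error the sum of a part to the
left of `c` and a part to the right of `c` grows linearly if both parts do at the same rate. -/
lemma tendsto_window_div {a b : ℕ → ℝ} {J : ℝ}
    (ha : Tendsto (fun n : ℕ => a n / n) atTop (𝓝 J))
    (hb : Tendsto (fun n : ℕ => b n / n) atTop (𝓝 J)) {L : ℤ × ℤ → ℝ} {c : ℤ} {s : ℝ}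
    (hL : ∀ m n : ℤ, m ≤ c → c ≤ n → |L (m, n) - b (c - m).toNat - a (n - c + 1).toNat| ≤ s) :
    Tendsto (fun p : ℤ × ℤ => L p / ((p.2 : ℝ) - p.1 + 1))
      (comap (fun p : ℤ × ℤ => p.2 - p.1) atTop ⊓ 𝓟 {p | p.1 ≤ c ∧ c ≤ p.2}) (𝓝 J) := by
  rw [Metric.tendsto_nhds]
  intro ε hε
  obtain ⟨C₁, hC₁, h1⟩ := exists_abs_sub_mul_le_of_tendsto ha (half_pos hε)
  obtain ⟨C₂, hC₂, h2⟩ := exists_abs_sub_mul_le_of_tendsto hb (half_pos hε)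
  obtain ⟨R, hR⟩ := exists_int_gt ((C₁ + C₂ + s) / (ε / 2))
  rw [div_lt_iff₀ (half_pos hε)] at hR
  rw [eventually_inf_principal]
  have hev : ∀ᶠ p : ℤ × ℤ in comap (fun p : ℤ × ℤ => p.2 - p.1) atTop, R ≤ p.2 - p.1 :=
    tendsto_comap.eventually (eventually_ge_atTop R)
  filter_upwards [hev] with ⟨m, n⟩ hp ⟨hm, hn⟩
  simp only at hp hm hn ⊢
  have e0 := hL m n hm hn
  have e1 := h1 (n - c + 1).toNat
  have e2 := h2 (c - m).toNat
  have k1 : (((n - c + 1).toNat : ℕ) : ℝ) = (n : ℝ) - c + 1 := by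
    have : (((n - c + 1).toNat : ℕ) : ℤ) = n - c + 1 := Int.toNat_of_nonneg (by omega)
    exact_mod_cast this
  have k2 : (((c - m).toNat : ℕ) : ℝ) = (c : ℝ) - m := by
    have : (((c - m).toNat : ℕ) : ℤ) = c - m := Int.toNat_of_nonneg (by omega)
    exact_mod_cast this
  rw [k1] at e1
  rw [k2] at e2
  have hm' : (m : ℝ) ≤ c := by exact_mod_cast hm
  have hn' : (c : ℝ) ≤ n := by exact_mod_cast hn
  have hp' : (R : ℝ) ≤ n - m := by exact_mod_cast hp
  have hpos : (0 : ℝ) < (n : ℝ) - m + 1 := by linarith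
  have hR' : C₁ + C₂ + s < ((n : ℝ) - m + 1) * (ε / 2) :=
    hR.trans_le (mul_le_mul_of_nonneg_right (by linarith) (half_pos hε).le)
  rw [Real.dist_eq, div_sub' hpos.ne', abs_div, abs_of_pos hpos, div_lt_iff₀ hpos]
  rw [abs_le] at e0 e1 e2
  rw [abs_lt]
  constructor <;> linarith [e0.1, e0.2, e1.1, e1.2, e2.1, e2.2]

end WindowLimit

/-! ### The log-determinant on the space of trajectories -/

section PathSpace

variable {N K : ℕ}

/-- Translation by `c` on the space of trajectories; `shift` is the translation by `1`. -/
def translate (c : ℤ) (x : ℤ → PairSpace N K) : ℤ → PairSpace N K :=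
  fun n => x (n + c)

/-- The shift as a measurable equivalence of the space of trajectories. -/
def shiftEquiv (N K : ℕ) : (ℤ → PairSpace N K) ≃ᵐ (ℤ → PairSpace N K) where
  toFun := shift N K
  invFun := translate (-1)
  left_inv x := by ext n : 1; simp [shift, translate]
  right_inv x := by ext n : 1; simp [shift, translate]
  measurable_toFun := measurable_pi_lambda _ fun n => measurable_pi_apply (n + 1)
  measurable_invFun := measurable_pi_lambda _ fun n => measurable_pi_apply (n + -1)

lemma shift_iterate (n : ℕ) : (shift N K)^[n] = translate (n : ℤ) := by
  induction n with
  | zero => ext x k : 2; simp [translate]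
  | succ n ih =>
    ext x k : 2
    rw [Function.iterate_succ_apply, ih]
    simp only [translate, shift]
    congr 1
    push_cast
    ring

lemma shiftEquiv_symm_iterate (n : ℕ) :
    (shiftEquiv N K).symm^[n] = translate (-(n : ℤ)) := by
  induction n with
  | zero => ext x k : 2; simp [translate]
  | succ n ih =>
    ext x k : 2
    rw [Function.iterate_succ_apply, ih]
    show x (k + -(n : ℤ) + -1) = x (k + -((n + 1 : ℕ) : ℤ))
    congr 1
    push_cast
    ring

/-- `log det (I + ρ H_{m,n} H_{m,n}*)` as a function of the trajectory. -/
def windowLogDet (ρ : ℝ) (m n : ℤ) (x : ℤ → PairSpace N K) : ℝ :=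
  logDet ρ (bandMatrix (fun k => Matrix.of (x k).1) (fun k => Matrix.of (x k).2) m n)

/-- The entry energy of the pair of blocks at the origin. -/
def originEnergy (x : ℤ → PairSpace N K) : ℝ :=
  energy (Matrix.of (x 0).1) (Matrix.of (x 0).2)

lemma measurable_originEnergy : Measurable (originEnergy (N := N) (K := K)) := by
  unfold originEnergy energy
  simp only [Matrix.of_apply]
  fun_prop

lemma measurable_logDet {Y r c : Type*} [MeasurableSpace Y] [Fintype r] [DecidableEq r]
    [Fintype c] (ρ : ℝ) {A : Y → Matrix r c ℂ} (hA : ∀ i j, Measurable fun y => A y i j) :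
    Measurable fun y => logDet ρ (A y) := by
  have hc : Continuous fun B : r → c → ℂ =>
      (1 + (ρ : ℂ) • (Matrix.of B * (Matrix.of B)ᴴ)).det.re := by
    refine Complex.continuous_re.comp (Continuous.matrix_det ?_)
    have hB : Continuous fun B : r → c → ℂ => (Matrix.of B : Matrix r c ℂ) := continuous_id
    exact continuous_const.add ((hB.matrix_mul hB.matrix_conjTranspose).const_smul (ρ : ℂ))
  exact Real.measurable_log.comp (hc.measurable.comp
    (measurable_pi_lambda _ fun i => measurable_pi_lambda _ fun j => hA i j))

lemma measurable_windowLogDet (ρ : ℝ) (m n : ℤ) :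
    Measurable (windowLogDet (N := N) (K := K) ρ m n) := by
  refine measurable_logDet ρ fun i j => ?_
  simp only [bandMatrix, Matrix.of_apply]
  split_ifs <;> fun_prop

lemma windowLogDet_translate (ρ : ℝ) (m n c : ℤ) (x : ℤ → PairSpace N K) :
    windowLogDet ρ m n (translate c x) = windowLogDet ρ (m + c) (n + c) x :=
  logDet_bandMatrix_shift (fun k => Matrix.of (x k).1) (fun k => Matrix.of (x k).2) ρ m n c

lemma originEnergy_translate (c : ℤ) (x : ℤ → PairSpace N K) :
    originEnergy (translate c x) = energy (Matrix.of (x c).1) (Matrix.of (x c).2) := by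
  simp [originEnergy, translate]

lemma windowLogDet_empty (ρ : ℝ) {m n : ℤ} (h : n < m) (x : ℤ → PairSpace N K) :
    windowLogDet ρ m n x = 0 :=
  logDet_bandMatrix_empty _ _ ρ h

lemma abs_windowLogDet_sub_le {ρ : ℝ} (hρ : 0 < ρ) {m n k : ℤ} (hmk : m ≤ k) (hkn : k ≤ n)
    (x : ℤ → PairSpace N K) :
    |windowLogDet ρ m n x - windowLogDet ρ m (k - 1) x - windowLogDet ρ k n x|
      ≤ ρ * originEnergy (translate k x) := by
  rw [originEnergy_translate]
  exact abs_logDet_bandMatrix_sub_le _ _ hρ hmk hkn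

lemma originEnergy_nonneg (x : ℤ → PairSpace N K) : 0 ≤ originEnergy x := energy_nonneg _ _

variable {μ : Measure (ℤ → PairSpace N K)}

lemma measurePreserving_translate (hT : Ergodic (shift N K) μ) (c : ℤ) :
    MeasurePreserving (translate c) μ μ := by
  rcases Int.eq_nat_or_neg c with ⟨n, rfl | rfl⟩
  · rw [← shift_iterate]
    exact hT.toMeasurePreserving.iterate n
  · rw [← shiftEquiv_symm_iterate]
    exact (Ergodic.symm (e := shiftEquiv N K) hT).toMeasurePreserving.iterate n

lemma integrable_windowLogDet {ρ : ℝ} (hρ : 0 < ρ) (hT : Ergodic (shift N K) μ)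
    (he : Integrable originEnergy μ) (m n : ℤ) : Integrable (windowLogDet ρ m n) μ := by
  rcases lt_or_ge n m with h | h
  · simp only [show windowLogDet ρ m n = fun _ => 0 from funext (windowLogDet_empty ρ h)]
    exact integrable_zero _ _ _
  · obtain ⟨d, hd⟩ := Int.le.dest h
    have key : ∀ d : ℕ, ∀ m : ℤ, Integrable (windowLogDet (N := N) (K := K) ρ m (m + d - 1)) μ := by
      intro d
      induction d with
      | zero =>
        intro m
        have : ∀ x : ℤ → PairSpace N K, windowLogDet ρ m (m + (0 : ℕ) - 1) x = 0 :=
          windowLogDet_empty ρ (by simp)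
        simp only [show windowLogDet ρ m (m + (0 : ℕ) - 1) = fun _ => 0 from funext this]
        exact integrable_zero _ _ _
      | succ d ih =>
        intro m
        have h1 : Integrable (fun x => windowLogDet ρ (m + 1) (m + 1 + d - 1) x
            + ρ * originEnergy (translate m x)) μ :=
          (ih (m + 1)).add
            (((measurePreserving_translate hT m).integrable_comp_of_integrable he).const_mul ρ)
        refine h1.mono' (measurable_windowLogDet ρ _ _).aestronglyMeasurable
          (Eventually.of_forall fun x => ?_)
        have h0 : 0 ≤ windowLogDet ρ m (m + (d + 1 : ℕ) - 1) x := logDet_nonneg hρ _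
        have h2 : m + 1 + (d : ℤ) - 1 = m + (d + 1 : ℕ) - 1 := by push_cast; ring
        rw [Real.norm_eq_abs, abs_of_nonneg h0, originEnergy_translate, h2]
        exact (logDet_bandMatrix_delete_first _ _ hρ (by push_cast; omega)).2
    have := key (d + 1) m
    rwa [show m + ((d + 1 : ℕ) : ℤ) - 1 = n by push_cast; omega] at this

/-- The linear growth rate `J` of the log-determinant: its expectations are within a bounded
distance from `length * J`, and almost surely it is the growth rate along all windows that
contain a given site. -/
theorem exists_growth_rate [IsProbabilityMeasure μ] {ρ : ℝ} (hρ : 0 < ρ)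
    (hT : Ergodic (shift N K) μ) (he : Integrable originEnergy μ) :
    ∃ J : ℝ, (∀ m n : ℤ, m ≤ n →
        |(∫ x, windowLogDet ρ m n x ∂μ) - ((n : ℝ) - m + 1) * J| ≤ ∫ x, ρ * originEnergy x ∂μ) ∧
      ∀ᵐ x ∂μ, ∀ c : ℤ, Tendsto
        (fun p : ℤ × ℤ => windowLogDet ρ p.1 p.2 x / ((p.2 : ℝ) - p.1 + 1))
        (comap (fun p : ℤ × ℤ => p.2 - p.1) atTop ⊓ 𝓟 {p | p.1 ≤ c ∧ c ≤ p.2}) (𝓝 J) := by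
  -- The windows to the right and to the left of the origin.
  set g : ℕ → (ℤ → PairSpace N K) → ℝ := fun n => windowLogDet ρ 0 (n - 1) with hg
  set h : ℕ → (ℤ → PairSpace N K) → ℝ := fun n => windowLogDet ρ (-n) (-1) with hh
  set s : (ℤ → PairSpace N K) → ℝ := fun x => ρ * originEnergy x with hs
  have hT' : Ergodic (shiftEquiv N K).symm μ := Ergodic.symm (e := shiftEquiv N K) hT
  have hW := integrable_windowLogDet hρ hT he
  have hgm : ∀ n, Measurable (g n) := fun n => measurable_windowLogDet ρ _ _
  have hhm : ∀ n, Measurable (h n) := fun n => measurable_windowLogDet ρ _ _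
  have hsm : Measurable s := measurable_originEnergy.const_mul ρ
  have hsi : Integrable s μ := he.const_mul ρ
  have hs0 : ∀ x, 0 ≤ s x := fun x => mul_nonneg hρ.le (originEnergy_nonneg x)
  have hgadd : ∀ m n x, |g (m + n) x - g m x - g n ((shift N K)^[m] x)|
      ≤ s ((shift N K)^[m] x) := by
    intro m n x
    rw [shift_iterate]
    simp only [hg, hs, windowLogDet_translate]
    rcases Nat.eq_zero_or_pos n with rfl | hn
    · rw [windowLogDet_empty ρ (show ((0 : ℕ) : ℤ) - 1 + m < 0 + m by omega)]
      simpa using hs0 (translate m x)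
    · have := abs_windowLogDet_sub_le hρ (show (0 : ℤ) ≤ m by omega)
        (show (m : ℤ) ≤ (m + n : ℕ) - 1 by omega) x
      rwa [zero_add, show (n : ℤ) - 1 + m = (m + n : ℕ) - 1 by push_cast; ring]
  have hhadd : ∀ m n x, |h (m + n) x - h m x - h n ((shiftEquiv N K).symm^[m] x)|
      ≤ s ((shiftEquiv N K).symm^[m] x) := by
    intro m n x
    rw [shiftEquiv_symm_iterate]
    simp only [hh, hs, windowLogDet_translate]
    rcases Nat.eq_zero_or_pos m with rfl | hm
    · rw [windowLogDet_empty ρ (show (-1 : ℤ) < -((0 : ℕ) : ℤ) by omega)]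
      simpa using hs0 (translate 0 x)
    · have := abs_windowLogDet_sub_le hρ (show -((m + n : ℕ) : ℤ) ≤ -(m : ℤ) by omega)
        (show -(m : ℤ) ≤ -1 by omega) x
      rw [sub_right_comm] at this
      rwa [show -(n : ℤ) + -m = -((m + n : ℕ) : ℤ) by push_cast; ring,
        show (-1 : ℤ) + -m = -m - 1 by ring]
  obtain ⟨J, hJ⟩ := exists_abs_sub_mul_le (a := fun n => ∫ x, g n x ∂μ) fun m n =>
    abs_integral_almost_additive_le hT.toMeasurePreserving hgm (fun n => hW _ _) hsm hsi hgadd m n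
  have hstat : ∀ m n c : ℤ, ∫ x, windowLogDet ρ (m + c) (n + c) x ∂μ
      = ∫ x, windowLogDet ρ m n x ∂μ := by
    intro m n c
    rw [← integral_comp_of_measurePreserving (measurePreserving_translate hT c)
      (measurable_windowLogDet ρ m n)]
    simp only [windowLogDet_translate]
  have hJ' : ∀ n : ℕ, |(∫ x, h n x ∂μ) - n * J| ≤ ∫ x, s x ∂μ := by
    intro n
    have := hstat 0 (n - 1) (-n)
    rw [zero_add, show (n : ℤ) - 1 + -n = -1 by ring] at this
    simp only [hh]
    rw [this]
    exact hJ n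
  refine ⟨J, fun m n hmn => ?_, ?_⟩
  · have h1 := hJ (n - m + 1).toNat
    have h2 : (((n - m + 1).toNat : ℕ) : ℤ) = n - m + 1 := Int.toNat_of_nonneg (by omega)
    have h3 : (((n - m + 1).toNat : ℕ) : ℝ) = (n : ℝ) - m + 1 := by exact_mod_cast h2
    have h4 := hstat 0 (n - m) m
    rw [zero_add, sub_add_cancel] at h4
    simp only [hg] at h1
    rwa [h3, h2, add_sub_cancel_right, ← h4] at h1
  · have H : ∀ᵐ x ∂μ, Tendsto (fun n : ℕ => g n x / n) atTop (𝓝 J) ∧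
        Tendsto (fun n : ℕ => h n x / n) atTop (𝓝 J) :=
      (tendsto_almost_additive_div hT hgm (fun n => hW _ _) hsm hsi hgadd hJ).and
        (tendsto_almost_additive_div hT' hhm (fun n => hW _ _) hsm hsi hhadd hJ')
    have H' := ae_all_iff.2 fun c =>
      (measurePreserving_translate hT c).quasiMeasurePreserving.ae H
    filter_upwards [H'] with x hx c
    refine tendsto_window_div (hx c).1 (hx c).2 (s := s (translate c x)) fun m n hm hn => ?_
    simp only [hg, hh, hs, windowLogDet_translate]
    rw [Int.toNat_of_nonneg (show 0 ≤ c - m by omega),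
      Int.toNat_of_nonneg (show 0 ≤ n - c + 1 by omega),
      show -(c - m) + c = m by ring, show -1 + c = c - 1 by ring, zero_add,
      show n - c + 1 - 1 + c = n by ring]
    exact abs_windowLogDet_sub_le hρ hm hn x

end PathSpace

/-! ### Transfer to the probability space of the process -/

section Channel

variable {N K : ℕ} {Ω : Type*} [MeasurableSpace Ω] {P : Measure Ω}
  {F G : ℤ → Ω → Matrix (Fin N) (Fin K) ℂ}

lemma IsErgodicChannel.measurable_trajectory (h : IsErgodicChannel P F G) :
    Measurable (trajectory F G) :=
  measurable_pi_lambda _ fun n =>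
    (measurable_pi_lambda _ fun i => measurable_pi_lambda _ fun j => h.measurable_F n i j).prodMk
      (measurable_pi_lambda _ fun i => measurable_pi_lambda _ fun j => h.measurable_G n i j)

lemma IsErgodicChannel.measurable_energy (h : IsErgodicChannel P F G) :
    Measurable fun ω => energy (F 0 ω) (G 0 ω) :=
  Finset.measurable_fun_sum _ fun i _ => Finset.measurable_fun_sum _ fun j _ =>
    ((h.measurable_F 0 i j).norm.pow_const 2).add ((h.measurable_G 0 i j).norm.pow_const 2)

lemma IsErgodicChannel.integrable_energy (h : IsErgodicChannel P F G) :
    Integrable (fun ω => energy (F 0 ω) (G 0 ω)) P := by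
  refine ((h.moment_F.add h.moment_G).const_mul (N : ℝ)).mono'
    h.measurable_energy.aestronglyMeasurable (Eventually.of_forall fun ω => ?_)
  rw [Real.norm_eq_abs, abs_of_nonneg (energy_nonneg _ _)]
  exact energy_le _ _

lemma IsErgodicChannel.integral_energy_le (h : IsErgodicChannel P F G) {B : ℝ}
    (hF : ∫ ω, specNorm (F 0 ω) ^ 2 ∂P ≤ B) (hG : ∫ ω, specNorm (G 0 ω) ^ 2 ∂P ≤ B) :
    ∫ ω, energy (F 0 ω) (G 0 ω) ∂P ≤ N * (2 * B) := by
  have h1 : ∫ ω, energy (F 0 ω) (G 0 ω) ∂P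
      ≤ ∫ ω, (N : ℝ) * (specNorm (F 0 ω) ^ 2 + specNorm (G 0 ω) ^ 2) ∂P :=
    integral_mono h.integrable_energy ((h.moment_F.add h.moment_G).const_mul _)
      fun ω => energy_le _ _
  rw [integral_const_mul, integral_add h.moment_F h.moment_G] at h1
  refine h1.trans (mul_le_mul_of_nonneg_left (by linarith) N.cast_nonneg)

lemma IsErgodicChannel.integrable_logDet_circMatrix {ρ : ℝ} (hρ : 0 < ρ)
    (h : IsErgodicChannel P F G)
    (hi : ∀ m n : ℤ, Integrable
      (fun ω => logDet ρ (bandMatrix (fun k => F k ω) (fun k => G k ω) m n)) P)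
    {n : ℤ} (hn : 0 < n) :
    Integrable (fun ω => logDet ρ (circMatrix (fun k => F k ω) (fun k => G k ω) 0 n)) P := by
  have hm : Measurable fun ω => logDet ρ (circMatrix (fun k => F k ω) (fun k => G k ω) 0 n) := by
    refine measurable_logDet ρ fun i j => ?_
    have h1 := h.measurable_F
    have h2 := h.measurable_G
    simp only [circMatrix, Matrix.of_apply]
    split_ifs
    · exact h2 _ _ _
    · exact h1 _ _ _
    · exact h1 _ _ _
    · exact measurable_const
  refine ((hi (0 + 1) n).add (h.integrable_energy.const_mul ρ)).mono'
    hm.aestronglyMeasurable (Eventually.of_forall fun ω => ?_)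
  rw [Real.norm_eq_abs, abs_of_nonneg (logDet_nonneg hρ _)]
  exact (logDet_circMatrix_delete_first _ _ hρ hn).2

end Channel

end ErgodicChannel

/-! ### The mutual information and its circular approximation -/

open ErgodicChannel in
theorem mainTheorem6 (ρ : ℝ) (hρ : 0 < ρ) (B : ℝ) :
    ∃ C : ℝ, ∀ (N K : ℕ), 0 < N → 0 < K →
      ∀ (Ω : Type*) [MeasurableSpace Ω] (P : Measure Ω) [IsProbabilityMeasure P]
        (F G : ℤ → Ω → Matrix (Fin N) (Fin K) ℂ),
        ErgodicChannel.IsErgodicChannel P F G →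
        ∫ ω, ErgodicChannel.specNorm (F 0 ω) ^ 2 ∂P ≤ B →
        ∫ ω, ErgodicChannel.specNorm (G 0 ω) ^ 2 ∂P ≤ B →
        ∃ I : ℝ, ErgodicChannel.IsMutualInformation P F G ρ I ∧
          ∀ M : ℕ, 1 ≤ M →
            Integrable (fun ω => ErgodicChannel.logDet ρ
              (ErgodicChannel.circMatrix (fun k => F k ω) (fun k => G k ω) 0 M)) P ∧
            |I - 1 / (((M : ℝ) + 1) * N) *
                ∫ ω, ErgodicChannel.logDet ρ
                  (ErgodicChannel.circMatrix (fun k => F k ω) (fun k => G k ω) 0 M) ∂P|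
              ≤ C / M := by
  refine ⟨4 * ρ * B, fun N K hN _ Ω _ P _ F G h hF hG => ?_⟩
  have hN' : (0 : ℝ) < N := by exact_mod_cast hN
  have ht := h.measurable_trajectory
  have : IsProbabilityMeasure (P.map (trajectory F G)) :=
    Measure.isProbabilityMeasure_map ht.aemeasurable
  have he : Integrable originEnergy (P.map (trajectory F G)) :=
    (integrable_map_measure measurable_originEnergy.aestronglyMeasurable ht.aemeasurable).2
      h.integrable_energy
  obtain ⟨J, hJ, hJae⟩ := exists_growth_rate hρ h.ergodic he
  have hi : ∀ m n : ℤ, Integrable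
      (fun ω => logDet ρ (bandMatrix (fun k => F k ω) (fun k => G k ω) m n)) P := fun m n =>
    (integrable_map_measure (measurable_windowLogDet ρ m n).aestronglyMeasurable
      ht.aemeasurable).1 (integrable_windowLogDet hρ h.ergodic he m n)
  have hE : ∫ x, ρ * originEnergy x ∂(P.map (trajectory F G))
      = ρ * ∫ ω, energy (F 0 ω) (G 0 ω) ∂P := by
    rw [integral_const_mul,
      integral_map ht.aemeasurable measurable_originEnergy.aestronglyMeasurable]
    rfl
  have hL : ∀ m n : ℤ, m ≤ n →
      |(∫ ω, logDet ρ (bandMatrix (fun k => F k ω) (fun k => G k ω) m n) ∂P)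
        - ((n : ℝ) - m + 1) * J| ≤ ρ * ∫ ω, energy (F 0 ω) (G 0 ω) ∂P := by
    intro m n hmn
    have h1 := hJ m n hmn
    rw [hE, integral_map ht.aemeasurable (measurable_windowLogDet ρ m n).aestronglyMeasurable] at h1
    exact h1
  set e : ℝ := ρ * ∫ ω, energy (F 0 ω) (G 0 ω) ∂P with he_def
  have he0 : 0 ≤ e := (abs_nonneg _).trans (hL 0 0 le_rfl)
  have heB : e ≤ 2 * ρ * B * N := by
    have := mul_le_mul_of_nonneg_left (h.integral_energy_le hF hG) hρ.le
    rw [he_def]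
    linarith
  refine ⟨J / N, ⟨fun m n _ => hi m n, ?_, ?_⟩, fun M hM => ?_⟩
  · have hlen : Tendsto (fun p : ℤ × ℤ => ((p.2 : ℝ) - p.1 + 1) * N)
        (comap (fun p : ℤ × ℤ => p.2 - p.1) atTop) atTop := by
      have h1 : Tendsto (fun p : ℤ × ℤ => ((p.2 - p.1 : ℤ) : ℝ))
          (comap (fun p : ℤ × ℤ => p.2 - p.1) atTop) atTop :=
        tendsto_intCast_atTop_atTop.comp tendsto_comap
      simp only [Int.cast_sub] at h1
      exact (tendsto_atTop_add_const_right _ _ h1).atTop_mul_const hN'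
    have hev : ∀ᶠ p : ℤ × ℤ in comap (fun p : ℤ × ℤ => p.2 - p.1) atTop, 0 ≤ p.2 - p.1 :=
      tendsto_comap.eventually (eventually_ge_atTop 0)
    rw [tendsto_iff_dist_tendsto_zero]
    refine squeeze_zero' (Eventually.of_forall fun _ => dist_nonneg) ?_
      (hlen.const_div_atTop e)
    filter_upwards [hev] with ⟨m, n⟩ hp
    simp only at hp ⊢
    have hp' : (0 : ℝ) ≤ (n : ℝ) - m := by exact_mod_cast hp
    have hpos : (0 : ℝ) < (n : ℝ) - m + 1 := by linarith
    have h1 := hL m n (by omega)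
    have h2 : ∀ a : ℝ, 1 / (((n : ℝ) - m + 1) * N) * a - J / N
        = (a - ((n : ℝ) - m + 1) * J) / (((n : ℝ) - m + 1) * N) := by
      intro a
      field_simp
    rw [Real.dist_eq, h2, abs_div, abs_of_pos (mul_pos hpos hN')]
    exact div_le_div_of_nonneg_right h1 (mul_pos hpos hN').le
  · filter_upwards [ae_of_ae_map ht.aemeasurable hJae] with ω hω c
    refine ((hω c).div_const (N : ℝ)).congr fun p => ?_
    rw [div_div, one_div_mul_eq_div]
    rfl
  · have hM' : (1 : ℝ) ≤ M := by exact_mod_cast hM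
    have hM0 : (0 : ℤ) < M := by exact_mod_cast hM
    have hci := h.integrable_logDet_circMatrix hρ hi hM0
    refine ⟨hci, ?_⟩
    set a := ∫ ω, logDet ρ (circMatrix (fun k => F k ω) (fun k => G k ω) 0 M) ∂P with ha
    set b := ∫ ω, logDet ρ (bandMatrix (fun k => F k ω) (fun k => G k ω) 0 M) ∂P with hb
    have h1 : |a - b| ≤ e := by
      rw [ha, hb, ← integral_sub hci (hi 0 M), he_def, ← integral_const_mul]
      exact abs_integral_le_integral_abs.trans
        (integral_mono (hci.sub (hi 0 M)).abs (h.integrable_energy.const_mul ρ)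
          fun ω => abs_logDet_circMatrix_sub_bandMatrix_le _ _ hρ hM0)
    have h2 := hL 0 M hM0.le
    rw [← hb] at h2
    push_cast at h2
    rw [sub_zero] at h2
    have hpos : (0 : ℝ) < (M + 1) * N := by positivity
    have h3 : J / N - 1 / (((M : ℝ) + 1) * N) * a
        = (((M : ℝ) + 1) * J - a) / (((M : ℝ) + 1) * N) := by
      field_simp
    have h4 : |((M : ℝ) + 1) * J - a| ≤ 4 * ρ * B * N := by
      rw [abs_le] at h1 h2 ⊢
      constructor <;> linarith [h1.1, h1.2, h2.1, h2.2]
    have hB0 : 0 ≤ 4 * ρ * B := by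
      have : 0 ≤ 2 * ρ * B * N := he0.trans heB
      have := nonneg_of_mul_nonneg_left this hN'
      linarith
    rw [h3, abs_div, abs_of_pos hpos]
    calc |((M : ℝ) + 1) * J - a| / (((M : ℝ) + 1) * N)
        ≤ 4 * ρ * B * N / (((M : ℝ) + 1) * N) := div_le_div_of_nonneg_right h4 hpos.le
      _ = 4 * ρ * B / ((M : ℝ) + 1) := by field_simp
      _ ≤ 4 * ρ * B / M := div_le_div_of_nonneg_left hB0 (by linarith) (by linarith)

end
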